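/- Let $G$ be a finite simple unicyclic graph, i.e. $G$ is connected and contains exactly one cycle $C$. For $v\in V(C)$ let the pendant tree $G\{v\}$ be the largest connected induced subgraph of $G$ that contains $v$ and no other vertex of $C$. For a finite graph $H$ with real adjacency matrix $A(H)$, call $H$ singular if $A(H)$ is singular, and let $\mathrm{Supp}(H)$ be the set of vertices $u$ of $H$ such that $x_u\neq 0$ for some real vector $x$ with $A(H)x=0$. Write $G-G\{v\}$ and $G-C$ for the subgraphs of $G$ induced by $V(G)\setminus V(G\{v\})$ and $V(G)\setminus V(C)$. Then $G$ is singular if and only if one of the following holds: (i) there is a vertex $v\in V(C)$ such that $v\notin\mathrm{Supp}(G\{v\})$ and at least one of $G\{v\}$ and $G-G\{v\}$ has no perfect matching; (ii) for every $v\in V(C)$ one has $v\in\mathrm{Supp}(G\{v\})$, and either some connected component (tree) of the forest $G-C$ has no perfect matching or the length of $C$ is divisible by $4$ (or both). -/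

import Mathlib

namespace SimpleGraph

variable {V : Type*}

/-- The null space of the real adjacency matrix of a finite graph. -/
noncomputable def nullSpace [Finite V] (G : SimpleGraph V) : Submodule ℝ (V → ℝ) :=
  letI := Fintype.ofFinite V
  letI := Classical.decRel G.Adj
  LinearMap.ker (G.adjMatrix ℝ).mulVecLin

/-- `Supp(G)`: the vertices at which some vector of the null space is nonzero. -/
def nullSupport [Finite V] (G : SimpleGraph V) : Set V :=
  ⋃ x ∈ G.nullSpace, Function.support x

/-- A finite graph is singular if its real adjacency matrix is singular. -/
def IsSingular [Finite V] (G : SimpleGraph V) : Prop :=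
  letI := Fintype.ofFinite V
  letI := Classical.decEq V
  letI := Classical.decRel G.Adj
  (G.adjMatrix ℝ).det = 0

/-- The graph has a perfect matching. -/
def HasPerfectMatching (G : SimpleGraph V) : Prop :=
  ∃ M : G.Subgraph, M.IsPerfectMatching

/-- The subgraph `C` of `G` is a cycle, i.e. it is traced out by a closed walk that is a cycle. -/
def Subgraph.IsCycleGraph {G : SimpleGraph V} (C : G.Subgraph) : Prop :=
  ∃ (u : V) (p : G.Walk u u), p.IsCycle ∧ p.toSubgraph = C

/-- A graph is unicyclic if it is connected and contains exactly one cycle. -/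
def IsUnicyclic (G : SimpleGraph V) : Prop :=
  G.Connected ∧ ∃! C : G.Subgraph, C.IsCycleGraph

/-- The vertex set of the pendant tree `G{v}`: the vertices that can be reached from `v` by a walk
meeting `C` only in `v`. The fact `isGreatest_pendantVerts` says that it is the largest vertex set
that contains `v` and no other vertex of `C` and induces a connected subgraph. -/
def pendantVerts (G : SimpleGraph V) (C : G.Subgraph) (v : V) : Set V :=
  {w | ∃ p : G.Walk v w, ∀ x ∈ p.support, x ∈ C.verts → x = v}

theorem mem_pendantVerts_self (G : SimpleGraph V) (C : G.Subgraph) (v : V) :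
    v ∈ G.pendantVerts C v :=
  ⟨Walk.nil, by simp⟩

theorem isGreatest_pendantVerts (G : SimpleGraph V) (C : G.Subgraph) (v : V) :
    IsGreatest {S : Set V | v ∈ S ∧ (∀ x ∈ S, x ∈ C.verts → x = v) ∧ (G.induce S).Connected}
      (G.pendantVerts C v) := by
  classical
  refine ⟨⟨G.mem_pendantVerts_self C v, ?_, ?_⟩, ?_⟩
  · rintro x ⟨p, hp⟩ hx
    exact hp x p.end_mem_support hx
  · refine induce_connected_of_patches v (G.mem_pendantVerts_self C v) ?_
    rintro w ⟨p, hp⟩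
    refine ⟨{x | x ∈ p.support}, ?_, p.start_mem_support, p.end_mem_support, ?_⟩
    · intro x hx
      exact ⟨p.takeUntil x hx, fun y hy => hp y (p.support_takeUntil_subset_support hx hy)⟩
    · exact p.connected_induce_support.preconnected _ _
  · rintro S ⟨hv, hS, hc⟩ w hw
    obtain ⟨q⟩ := hc.preconnected ⟨v, hv⟩ ⟨w, hw⟩
    refine ⟨q.map (Embedding.induce S).toHom, fun x hx => hS x ?_⟩
    have h := Walk.support_map (Embedding.induce (G := G) S).toHom q
    obtain ⟨y, -, rfl⟩ := List.mem_map.1 ((congrArg (x ∈ ·) h).mp hx)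
    exact y.2

/-- The pendant tree `G{v}` of `G` at the vertex `v` of the cycle `C`. -/
def pendantTree (G : SimpleGraph V) (C : G.Subgraph) (v : V) :
    SimpleGraph (G.pendantVerts C v) :=
  G.induce (G.pendantVerts C v)

/-- The vertex `v`, as a vertex of `G{v}`. -/
def pendantRoot (G : SimpleGraph V) (C : G.Subgraph) (v : V) : G.pendantVerts C v :=
  ⟨v, G.mem_pendantVerts_self C v⟩

end SimpleGraph

/-! Write `A` for the adjacency matrix of `G`. The null space of `A` is compared with those of
forests and of `C`, in two cases. Suppose `v` on `C` is not in the support of `T = G{v}`. By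
symmetry the equation `A(T) y = e_v` is solvable, and `y` vanishes at `v` because `T` is bipartite.
Extended by zero, `y` solves `A y = e_v` in all of `G`. Pairing it with a null vector of `G` shows
that this vector vanishes at `v`, and multiples of `y` repair null vectors of `G - T`. Hence `G` is
singular iff `T` or `G - T` is (`singularOn_univ_iff_of_notMem_support`). Otherwise each `v` on `C`
has a null vector `z_v` of `G{v}` with value 1 at `v`, and `A z_v` is the indicator of the
neighbours of `v` on `C`. Pairing with `z_v` and forming `∑ c_v z_v` show that `G` is singular iff
`G - C` or `C` is (`singularOn_univ_iff_of_forall_mem_support`). Forests are settled by leaf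
deletion, the cycle by the recurrence `x_{i+2} = -x_i`. Uniqueness of the cycle makes every edge off
`C` a bridge, so `C` is induced and pendant trees are attached only at their roots. -/

namespace SimpleGraph

open Matrix
open scoped Classical

variable {V : Type*}

/-! ### Null vectors of induced subgraphs, and splitting at an unsupported vertex -/

section Kernel

/-- The extension by zero of a function on a set. -/
noncomputable def extendZero {S : Set V} (y : S → ℝ) (v : V) : ℝ :=
  if h : v ∈ S then y ⟨v, h⟩ else 0

theorem extendZero_coe {S : Set V} (y : S → ℝ) (v : S) : extendZero y (v : V) = y v := by
  simp [extendZero]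

theorem extendZero_of_notMem {S : Set V} (y : S → ℝ) {v : V} (hv : v ∉ S) :
    extendZero y v = 0 := by
  simp [extendZero, hv]

variable [Fintype V]

/-- `x` is supported on `S` and restricts to a null vector of the subgraph induced by `S`. -/
def IsKernelOn (G : SimpleGraph V) (S : Set V) (x : V → ℝ) : Prop :=
  (∀ v ∉ S, x v = 0) ∧ ∀ v ∈ S, (G.adjMatrix ℝ *ᵥ x) v = 0

/-- The subgraph induced by `S` is singular. -/
def SingularOn (G : SimpleGraph V) (S : Set V) : Prop :=
  ∃ x, x ≠ 0 ∧ G.IsKernelOn S x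

theorem adjMatrix_mulVec_eq_sum_ite (G : SimpleGraph V) [DecidableRel G.Adj] (x : V → ℝ) (v : V) :
    (G.adjMatrix ℝ *ᵥ x) v = ∑ u, if G.Adj v u then x u else 0 := by
  simp [mulVec, dotProduct, adjMatrix_apply]

theorem adjMatrix_mulVec_congr (G : SimpleGraph V) {x y : V → ℝ} {v : V}
    (h : ∀ u, G.Adj v u → x u = y u) :
    (G.adjMatrix ℝ *ᵥ x) v = (G.adjMatrix ℝ *ᵥ y) v := by
  rw [adjMatrix_mulVec_apply, adjMatrix_mulVec_apply]
  exact Finset.sum_congr rfl fun u hu => h u (by simpa using hu)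

theorem adjMatrix_mulVec_eq_zero (G : SimpleGraph V) {x : V → ℝ} {v : V}
    (h : ∀ u, G.Adj v u → x u = 0) : (G.adjMatrix ℝ *ᵥ x) v = 0 := by
  rw [adjMatrix_mulVec_apply]
  exact Finset.sum_eq_zero fun u hu => h u (by simpa using hu)

theorem adjMatrix_mulVec_eq_of_unique_adj (G : SimpleGraph V) {x : V → ℝ} {v w : V}
    (hw : G.Adj v w) (h : ∀ u, G.Adj v u → u ≠ w → x u = 0) :
    (G.adjMatrix ℝ *ᵥ x) v = x w := by
  rw [adjMatrix_mulVec_apply]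
  exact Finset.sum_eq_single w (fun u hu huw => h u (by simpa using hu) huw) (by simp [hw])

theorem adjMatrix_mulVec_add_single (G : SimpleGraph V) (x : V → ℝ) (v u : V) (c : ℝ) :
    (G.adjMatrix ℝ *ᵥ (x + Pi.single v c)) u =
      (G.adjMatrix ℝ *ᵥ x) u + if G.Adj u v then c else 0 := by
  rw [mulVec_add, Pi.add_apply]
  congr 1
  simp

theorem dotProduct_adjMatrix_mulVec_comm (G : SimpleGraph V) (x y : V → ℝ) :
    x ⬝ᵥ (G.adjMatrix ℝ *ᵥ y) = y ⬝ᵥ (G.adjMatrix ℝ *ᵥ x) := by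
  rw [dotProduct_mulVec, ← mulVec_transpose, transpose_adjMatrix, dotProduct_comm]

theorem induce_adjMatrix_mulVec (G : SimpleGraph V) (S : Set V) (y : S → ℝ) (v : S) :
    ((G.induce S).adjMatrix ℝ *ᵥ y) v = (G.adjMatrix ℝ *ᵥ extendZero y) v := by
  rw [adjMatrix_mulVec_eq_sum_ite, adjMatrix_mulVec_eq_sum_ite,
    ← Finset.sum_subset (Finset.subset_univ S.toFinset)
      (fun u _ hu => by simp [extendZero_of_notMem y (by simpa using hu : u ∉ S)]),
    Finset.sum_subtype S.toFinset (p := (· ∈ S)) (by simp)]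
  exact Finset.sum_congr rfl fun u _ => by simp [extendZero_coe]

theorem isKernelOn_extendZero_iff (G : SimpleGraph V) (S : Set V) (y : S → ℝ) :
    G.IsKernelOn S (extendZero y) ↔ (G.induce S).adjMatrix ℝ *ᵥ y = 0 := by
  refine ⟨fun h => funext fun v => ?_, fun h => ⟨fun v hv => extendZero_of_notMem y hv, ?_⟩⟩
  · rw [induce_adjMatrix_mulVec]
    exact h.2 v v.2
  · intro v hv
    rw [← induce_adjMatrix_mulVec G S y ⟨v, hv⟩, h]
    rfl

theorem mem_nullSupport_iff (G : SimpleGraph V) (v : V) :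
    v ∈ G.nullSupport ↔ ∃ x, G.adjMatrix ℝ *ᵥ x = 0 ∧ x v ≠ 0 := by
  simp only [nullSupport, nullSpace, Set.mem_iUnion, LinearMap.mem_ker, mulVecLin_apply,
    Function.mem_support, exists_prop]
  refine exists_congr fun x => and_congr_left fun _ => ?_
  convert Iff.rfl
  rfl

theorem mem_nullSupport_induce_iff (G : SimpleGraph V) (S : Set V) (v : S) :
    v ∈ (G.induce S).nullSupport ↔ ∃ x, G.IsKernelOn S x ∧ x v ≠ 0 := by
  rw [mem_nullSupport_iff]
  constructor
  · rintro ⟨y, hy, hv⟩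
    exact ⟨extendZero y, (isKernelOn_extendZero_iff G S y).2 hy, by rwa [extendZero_coe]⟩
  · rintro ⟨x, hx, hv⟩
    refine ⟨fun u => x u, (isKernelOn_extendZero_iff G S _).1 ?_, hv⟩
    convert hx using 1
    funext u
    by_cases hu : u ∈ S
    · simp [extendZero, hu]
    · rw [extendZero_of_notMem _ hu, hx.1 u hu]

theorem isSingular_iff_singularOn_univ (G : SimpleGraph V) :
    G.IsSingular ↔ G.SingularOn Set.univ := by
  have h : G.IsSingular ↔ (G.adjMatrix ℝ).det = 0 := by
    unfold IsSingular
    convert Iff.rfl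
  rw [h, ← exists_mulVec_eq_zero_iff]
  refine exists_congr fun x => and_congr Iff.rfl ?_
  simp [IsKernelOn, funext_iff]

/-- The functional `x ↦ x v` kills the kernel, so it factors as `g ∘ M`. By symmetry of `M`, the
coefficients of `g` form the solution. -/
theorem _root_.Matrix.IsSymm.exists_mulVec_eq_single {n : Type*} [Fintype n] [DecidableEq n]
    {M : Matrix n n ℝ} (hM : M.IsSymm) (v : n) (h : ∀ x, M *ᵥ x = 0 → x v = 0) :
    ∃ y, M *ᵥ y = Pi.single v 1 := by
  have hmem : (LinearMap.proj v : (n → ℝ) →ₗ[ℝ] ℝ) ∈ (LinearMap.ker M.mulVecLin).dualAnnihilator := by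
    rw [Submodule.mem_dualAnnihilator]
    intro x hx
    exact h x hx
  rw [← LinearMap.range_dualMap_eq_dualAnnihilator_ker] at hmem
  obtain ⟨g, hg⟩ := hmem
  refine ⟨fun w => g (Pi.single w 1), funext fun w => ?_⟩
  have hw := LinearMap.congr_fun hg (Pi.single w 1)
  simp only [LinearMap.dualMap_apply, mulVecLin_apply, LinearMap.proj_apply] at hw
  have hcol : M *ᵥ Pi.single w 1 = ∑ u, M u w • (Pi.single u 1 : n → ℝ) := by
    funext k
    simp [Finset.sum_apply, Pi.single_apply]
  rw [hcol, map_sum] at hw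
  simp only [map_smul, smul_eq_mul] at hw
  rw [Pi.single_comm] at hw
  rw [← hw]
  simp only [mulVec, dotProduct]
  exact Finset.sum_congr rfl fun u _ => by rw [hM.apply]

theorem exists_adjMatrix_mulVec_eq_single_on (G : SimpleGraph V) {S : Set V} {v : V} (hv : v ∈ S)
    (h : ∀ x, G.IsKernelOn S x → x v = 0) :
    ∃ y : V → ℝ, (∀ u ∉ S, y u = 0) ∧
      ∀ u ∈ S, (G.adjMatrix ℝ *ᵥ y) u = if u = v then 1 else 0 := by
  obtain ⟨y, hy⟩ := ((G.induce S).isSymm_adjMatrix (α := ℝ)).exists_mulVec_eq_single ⟨v, hv⟩ (by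
    intro x hx
    have := h _ ((isKernelOn_extendZero_iff G S x).2 hx)
    rwa [← extendZero_coe x ⟨v, hv⟩])
  refine ⟨extendZero y, fun u hu => extendZero_of_notMem y hu, fun u hu => ?_⟩
  rw [← induce_adjMatrix_mulVec G S y ⟨u, hu⟩, hy]
  simp [Pi.single_apply]

/-- In a bipartite induced subgraph, a solution of `A y = e_v` vanishes at `v`, if all null vectors
do. -/
theorem apply_eq_zero_of_isBipartite (G : SimpleGraph V) {S : Set V} {v : V} (hv : v ∈ S)
    (hS : (G.induce S).IsBipartite) (h : ∀ x, G.IsKernelOn S x → x v = 0) {y : V → ℝ}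
    (hy0 : ∀ u ∉ S, y u = 0)
    (hy : ∀ u ∈ S, (G.adjMatrix ℝ *ᵥ y) u = if u = v then 1 else 0) : y v = 0 := by
  obtain ⟨c⟩ := hS
  -- The colour class of `v`. Cutting `y` down to `B` gives a null vector: vertices of `B` have no
  -- neighbour in `B`, and the other vertices of `S` see the same sum as for `y`, which is 0 there.
  let B : Set V := {u | ∃ hu : u ∈ S, c ⟨u, hu⟩ = c ⟨v, hv⟩}
  have hker : G.IsKernelOn S (fun u => if u ∈ B then y u else 0) := by
    refine ⟨fun u hu => by simp [hy0 u hu], fun u hu => ?_⟩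
    by_cases huB : u ∈ B
    · refine adjMatrix_mulVec_eq_zero G fun w hw => ?_
      refine if_neg ?_
      rintro ⟨hwS, hcw⟩
      obtain ⟨_, hcu⟩ := huB
      have := c.valid (v := ⟨u, hu⟩) (w := ⟨w, hwS⟩) hw
      exact this (hcu.trans hcw.symm)
    · have huv : u ≠ v := by
        rintro rfl
        exact huB ⟨hv, rfl⟩
      refine (adjMatrix_mulVec_congr G fun w hw => ?_).trans ((hy u hu).trans (if_neg huv))
      by_cases hwS : w ∈ S
      · refine if_pos ⟨hwS, ?_⟩
        have h1 := c.valid (v := ⟨u, hu⟩) (w := ⟨w, hwS⟩) hw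
        have h2 : c ⟨u, hu⟩ ≠ c ⟨v, hv⟩ := fun h => huB ⟨hu, h⟩
        omega
      · rw [hy0 w hwS, ite_self]
  have := h _ hker
  rwa [if_pos ⟨hv, rfl⟩] at this

/-- If `v` is the only vertex of `S` with neighbours outside `S`, and is not in the support of the
bipartite subgraph induced by `S`, then singularity decomposes over `S` and its complement. -/
theorem singularOn_univ_iff_of_notMem_support (G : SimpleGraph V) {S : Set V} {v : V} (hv : v ∈ S)
    (hcut : ∀ u ∈ S, u ≠ v → ∀ w, G.Adj u w → w ∈ S)
    (hS : (G.induce S).IsBipartite) (h : ∀ x, G.IsKernelOn S x → x v = 0) :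
    G.SingularOn Set.univ ↔ G.SingularOn S ∨ G.SingularOn Sᶜ := by
  obtain ⟨y, hy0, hy⟩ := G.exists_adjMatrix_mulVec_eq_single_on hv h
  have hyv := G.apply_eq_zero_of_isBipartite hv hS h hy0 hy
  have hout : ∀ u ∉ S, ∀ w ∈ S, G.Adj u w → w = v := by
    intro u hu w hw huw
    by_contra hne
    exact hu (hcut w hw hne u huw.symm)
  have hyout : ∀ u ∉ S, (G.adjMatrix ℝ *ᵥ y) u = 0 := by
    intro u hu
    refine adjMatrix_mulVec_eq_zero G fun w hw => ?_
    by_cases hwS : w ∈ S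
    · rw [hout u hu w hwS hw, hyv]
    · exact hy0 w hwS
  have hyA : G.adjMatrix ℝ *ᵥ y = Pi.single v 1 := by
    funext u
    by_cases hu : u ∈ S
    · simp [hy u hu, Pi.single_apply]
    · rw [hyout u hu, Pi.single_eq_of_ne]
      rintro rfl
      exact hu hv
  constructor
  · rintro ⟨x, hx0, -, hx⟩
    have hxA : G.adjMatrix ℝ *ᵥ x = 0 := funext fun u => hx u trivial
    have hxv : x v = 0 := by
      have := G.dotProduct_adjMatrix_mulVec_comm x y
      rw [hyA, hxA] at this
      simpa using this
    by_cases hout0 : ∀ u ∉ S, x u = 0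
    · exact Or.inl ⟨x, hx0, hout0, fun u _ => hx u trivial⟩
    · push Not at hout0
      obtain ⟨w, hw, hxw⟩ := hout0
      refine Or.inr ⟨fun u => if u ∈ S then 0 else x u, fun h0 => hxw ?_, fun u hu => ?_,
        fun u hu => ?_⟩
      · simpa [hw] using congrFun h0 w
      · exact if_pos (by simpa using hu)
      · refine (adjMatrix_mulVec_congr G fun t ht => ?_).trans (hx u trivial)
        by_cases htS : t ∈ S
        · rw [if_pos htS, hout u hu t htS ht, hxv]
        · rw [if_neg htS]
  · rintro (⟨x, hx0, hx1, hx⟩ | ⟨x, hx0, hx1, hx⟩)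
    · refine ⟨x, hx0, by simp, fun u _ => ?_⟩
      by_cases hu : u ∈ S
      · exact hx u hu
      · refine adjMatrix_mulVec_eq_zero G fun w hw => ?_
        by_cases hwS : w ∈ S
        · rw [hout u hu w hwS hw]
          exact h x ⟨hx1, hx⟩
        · exact hx1 w hwS
    -- The extension by zero of `x` fails only the equation at `v`, by the amount `s`; subtracting
    -- `s • y` corrects this without changing values off `S`.
    · set s := (G.adjMatrix ℝ *ᵥ x) v with hs
      refine ⟨x + (-s) • y, fun h0 => hx0 ?_, by simp, fun u _ => ?_⟩
      · funext u
        by_cases hu : u ∈ S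
        · exact hx1 u (by simpa using hu)
        · simpa [hy0 u hu] using congrFun h0 u
      · rw [mulVec_add, mulVec_smul, hyA, Pi.add_apply]
        by_cases huv : u = v
        · subst huv
          simp [← hs]
        · have : (G.adjMatrix ℝ *ᵥ x) u = 0 := by
            by_cases hu : u ∈ S
            · exact adjMatrix_mulVec_eq_zero G fun w hw => hx1 w (by simpa using hcut u hu huv w hw)
            · exact hx u hu
          simp [this, huv]

end Kernel

/-! ### Perfect matchings as involutions -/

section Matching

/-- The subgraph induced by `S` has a perfect matching, given as a fixed-point free involution. -/
def MatchedOn (G : SimpleGraph V) (S : Set V) : Prop :=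
  ∃ f : V → V, ∀ v ∈ S, f v ∈ S ∧ G.Adj v (f v) ∧ f (f v) = v

theorem hasPerfectMatching_iff_exists_involution (G : SimpleGraph V) :
    G.HasPerfectMatching ↔ ∃ f : V → V, ∀ v, G.Adj v (f v) ∧ f (f v) = v := by
  constructor
  · rintro ⟨M, hM⟩
    rw [Subgraph.isPerfectMatching_iff] at hM
    choose f hf hu using hM
    exact ⟨f, fun v => ⟨(hf v).adj_sub, (hu (f v) v (hf v).symm).symm⟩⟩
  · rintro ⟨f, hf⟩
    refine ⟨⟨Set.univ, fun v w => w = f v, ?_, by simp, ⟨?_⟩⟩, ?_⟩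
    · rintro v w rfl
      exact (hf v).1
    · rintro v w rfl
      exact (hf v).2.symm
    · rw [Subgraph.isPerfectMatching_iff]
      exact fun v => ⟨f v, rfl, fun w hw => hw⟩

theorem hasPerfectMatching_induce_iff (G : SimpleGraph V) (S : Set V) :
    (G.induce S).HasPerfectMatching ↔ G.MatchedOn S := by
  rw [hasPerfectMatching_iff_exists_involution]
  constructor
  · rintro ⟨f, hf⟩
    refine ⟨fun v => if h : v ∈ S then f ⟨v, h⟩ else v, fun v hv => ?_⟩
    have := hf ⟨v, hv⟩
    simp only [hv, dif_pos, Subtype.coe_prop, this.2, and_true, true_and]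
    exact this.1
  · rintro ⟨f, hf⟩
    exact ⟨fun v => ⟨f v, (hf v v.2).1⟩, fun v => ⟨(hf v v.2).2.1, Subtype.ext (hf v v.2).2.2⟩⟩

theorem hasPerfectMatching_iff_forall_connectedComponent (G : SimpleGraph V) :
    G.HasPerfectMatching ↔
      ∀ T : G.ConnectedComponent, T.toSimpleGraph.HasPerfectMatching := by
  have key : ∀ T : G.ConnectedComponent, T.toSimpleGraph.HasPerfectMatching ↔ G.MatchedOn T.supp :=
    fun T => hasPerfectMatching_induce_iff G T.supp
  simp only [key]
  rw [hasPerfectMatching_iff_exists_involution]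
  constructor
  · rintro ⟨f, hf⟩ T
    refine ⟨f, fun v hv => ⟨?_, hf v⟩⟩
    exact (T.mem_supp_congr_adj (hf v).1).1 hv
  · intro h
    choose f hf using h
    refine ⟨fun v => f (G.connectedComponentMk v) v, fun v => ?_⟩
    obtain ⟨h1, h2, h3⟩ := hf (G.connectedComponentMk v) v rfl
    refine ⟨h2, ?_⟩
    rw [ConnectedComponent.mem_supp_iff] at h1
    simp only [h1, h3]

end Matching

/-! ### Singular forests -/

section Forest

/-- A component is a tree: it has a leaf, or it is a single isolated vertex. Both cases serve leaf
deletion. -/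
theorem IsAcyclic.exists_subsingleton_adj [Finite V] [Nonempty V] {G : SimpleGraph V}
    (hG : G.IsAcyclic) : ∃ v, ∀ a b, G.Adj v a → G.Adj v b → a = b := by
  have := Fintype.ofFinite V
  obtain ⟨v₀⟩ := ‹Nonempty V›
  let T := G.connectedComponentMk v₀
  have hT := hG.isTree_connectedComponent T
  have hmem : ∀ {v a : V}, v ∈ T.supp → G.Adj v a → a ∈ T.supp :=
    fun hv ha => (T.mem_supp_congr_adj ha).1 hv
  by_cases hn : Nontrivial T.supp
  · obtain ⟨v, hv⟩ := hT.exists_vert_degree_one_of_nontrivial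
    rw [degree_eq_one_iff_existsUnique_adj] at hv
    refine ⟨v, fun a b ha hb => ?_⟩
    have := hv.unique (y₁ := ⟨a, hmem v.2 ha⟩) (y₂ := ⟨b, hmem v.2 hb⟩) ha hb
    exact congrArg Subtype.val this
  · rw [not_nontrivial_iff_subsingleton] at hn
    refine ⟨v₀, fun a b ha hb => ?_⟩
    have := hn.elim ⟨a, hmem rfl ha⟩ ⟨b, hmem rfl hb⟩
    exact congrArg Subtype.val this

theorem isAcyclic_induce_mono {G : SimpleGraph V} {S T : Set V} (h : T ⊆ S)
    (hS : (G.induce S).IsAcyclic) : (G.induce T).IsAcyclic :=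
  hS.comap (induceHomOfLE G h).toHom (induceHomOfLE G h).injective

/-- A forest is singular if and only if it has no perfect matching. -/
theorem singularOn_iff_not_matchedOn [Fintype V] (G : SimpleGraph V) (S : Set V)
    (hS : (G.induce S).IsAcyclic) : G.SingularOn S ↔ ¬ G.MatchedOn S := by
  induction hn : S.ncard using Nat.strong_induction_on generalizing S with
  | _ n ih =>
  subst hn
  rcases S.eq_empty_or_nonempty with rfl | hne
  · refine iff_of_false ?_ (not_not.2 ⟨id, by simp⟩)
    rintro ⟨x, hx, h0, -⟩
    exact hx (funext fun v => h0 v (by simp))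
  have := hne.to_subtype
  obtain ⟨⟨v, hv⟩, hleaf⟩ := hS.exists_subsingleton_adj
  replace hleaf : ∀ a ∈ S, ∀ b ∈ S, G.Adj v a → G.Adj v b → a = b := fun a ha b hb h1 h2 =>
    congrArg Subtype.val (hleaf ⟨a, ha⟩ ⟨b, hb⟩ h1 h2)
  by_cases hiso : ∃ w ∈ S, G.Adj v w
  swap
  · push Not at hiso
    -- An isolated vertex carries a null vector and cannot be matched.
    refine iff_of_true ⟨Pi.single v 1, by simp, fun u hu => ?_, fun u hu => ?_⟩ ?_
    · exact Pi.single_eq_of_ne (by rintro rfl; exact hu hv) _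
    · refine adjMatrix_mulVec_eq_zero G fun w hw => ?_
      refine Pi.single_eq_of_ne ?_ _
      rintro rfl
      exact hiso u hu hw.symm
    · rintro ⟨f, hf⟩
      exact hiso _ (hf v hv).1 (hf v hv).2.1
  obtain ⟨w, hw, hvw⟩ := hiso
  set S' := S \ {v, w} with hS'
  have hsub : S' ⊆ S := Set.sdiff_subset
  have hlt : S'.ncard < S.ncard := by
    refine Set.ncard_lt_ncard ⟨hsub, fun h => ?_⟩
    exact (h hv).2 (by simp)
  -- The equation at the leaf `v` forces `x w = 0`, and the value at `v` enters only the equation at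
  -- `w`, which determines it.
  have hSing : G.SingularOn S ↔ G.SingularOn S' := by
    have hnadj : ∀ u ∈ S', ¬ G.Adj u v := by
      intro u hu huv
      exact hu.2 (Or.inr (hleaf u hu.1 w hw huv.symm hvw))
    constructor
    · rintro ⟨x, hx0, hx1, hx⟩
      have hxw : x w = 0 := by
        rw [← hx v hv]
        refine (adjMatrix_mulVec_eq_of_unique_adj G hvw fun u hu huw => hx1 u fun huS => ?_).symm
        exact huw (hleaf u huS w hw hu hvw)
      refine ⟨x + Pi.single v (-x v), fun h0 => hx0 ?_, fun u hu => ?_, fun u hu => ?_⟩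
      · have hxu : ∀ u, u ≠ v → x u = 0 := fun u hu => by simpa [hu] using congrFun h0 u
        funext u
        by_cases huv : u = v
        · subst huv
          have := hx w hw
          rwa [adjMatrix_mulVec_eq_of_unique_adj G hvw.symm fun t _ ht => hxu t ht] at this
        · exact hxu u huv
      · by_cases huv : u = v
        · subst huv
          simp
        · simp only [Pi.add_apply, Pi.single_eq_of_ne huv, add_zero]
          by_cases huw : u = w
          · rw [huw, hxw]
          · exact hx1 u fun huS => hu ⟨huS, by simp [huv, huw]⟩
      · rw [adjMatrix_mulVec_add_single, hx u hu.1, if_neg (hnadj u hu), add_zero]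
    · rintro ⟨x, hx0, hx1, hx⟩
      have hxv : x v = 0 := hx1 v fun h => h.2 (by simp)
      have hxw : x w = 0 := hx1 w fun h => h.2 (by simp)
      refine ⟨x + Pi.single v (-(G.adjMatrix ℝ *ᵥ x) w), fun h0 => hx0 ?_, fun u hu => ?_,
        fun u hu => ?_⟩
      · funext u
        by_cases huv : u = v
        · rw [huv, hxv]
          rfl
        · simpa [huv] using congrFun h0 u
      · have huv : u ≠ v := by
          rintro rfl
          exact hu hv
        simp [huv, hx1 u fun h => hu h.1]
      · rw [adjMatrix_mulVec_add_single]
        by_cases huw : u = w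
        · subst huw
          simp [hvw.symm]
        by_cases huv : u = v
        · subst huv
          rw [if_neg G.irrefl, add_zero,
            adjMatrix_mulVec_eq_of_unique_adj G hvw fun t ht htw => ?_, hxw]
          exact hx1 t fun h => htw (hleaf t h.1 w hw ht hvw)
        · have hu' : u ∈ S' := ⟨hu, by simp [huv, huw]⟩
          rw [hx u hu', if_neg (hnadj u hu'), add_zero]
  have hMatch : G.MatchedOn S ↔ G.MatchedOn S' := by
    constructor
    · rintro ⟨f, hf⟩
      have hfv : f v = w := hleaf _ (hf v hv).1 w hw (hf v hv).2.1 hvw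
      have hfw : f w = v := by rw [← hfv, (hf v hv).2.2]
      refine ⟨f, fun u hu => ⟨⟨(hf u hu.1).1, ?_⟩, (hf u hu.1).2⟩⟩
      have hff := (hf u hu.1).2.2
      rintro (h | h)
      · exact hu.2 (Or.inr (by rw [← hff, h, hfv]; rfl))
      · exact hu.2 (Or.inl (by rw [← hff, h, hfw]))
    · rintro ⟨f, hf⟩
      have hne : w ≠ v := hvw.ne'
      refine ⟨fun u => if u = v then w else if u = w then v else f u, fun u hu => ?_⟩
      by_cases huv : u = v
      · subst huv
        simp [hne, hw, hvw]
      by_cases huw : u = w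
      · subst huw
        simp [hne, hv, hvw.symm]
      obtain ⟨⟨h1, h2⟩, h3, h4⟩ := hf u ⟨hu, by simp [huv, huw]⟩
      simp only [Set.mem_insert_iff, Set.mem_singleton_iff, not_or] at h2
      simp [huv, huw, h1, h2.1, h2.2, h3, h4]
  rw [hSing, hMatch]
  exact ih _ hlt S' (isAcyclic_induce_mono hsub hS) rfl

end Forest

/-! ### Splitting when all roots are supported -/

/-- If every `v ∈ D` is in the support of a subgraph `P v` which is attached to the rest of the graph
at `v`, by edges inside `D`, then singularity decomposes over `D` and its complement. -/
theorem singularOn_univ_iff_of_forall_mem_support [Fintype V] (G : SimpleGraph V) {D : Set V}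
    {P : V → Set V} (hPD : ∀ v ∈ D, ∀ w ∈ P v, w ∈ D → w = v)
    (hcut : ∀ v ∈ D, ∀ w ∈ P v, w ≠ v → ∀ u, G.Adj w u → u ∈ P v)
    (hroot : ∀ v ∈ D, ∀ u, G.Adj v u → u ∉ P v → u ∈ D)
    (hsupp : ∀ v ∈ D, ∃ z, G.IsKernelOn (P v) z ∧ z v ≠ 0) :
    G.SingularOn Set.univ ↔ G.SingularOn Dᶜ ∨ G.SingularOn D := by
  have hnorm : ∀ v ∈ D, ∃ z : V → ℝ, (∀ u ∉ P v, z u = 0) ∧ z v = 1 ∧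
      ∀ u, (G.adjMatrix ℝ *ᵥ z) u = if u ∈ D ∧ G.Adj v u then 1 else 0 := by
    intro v hv
    obtain ⟨z, ⟨hz0, hz⟩, hzv⟩ := hsupp v hv
    refine ⟨(z v)⁻¹ • z, fun u hu => by simp [hz0 u hu], by simp [hzv], fun u => ?_⟩
    rw [mulVec_smul, Pi.smul_apply, smul_eq_mul]
    by_cases hu : u ∈ P v
    · rw [hz u hu, if_neg, mul_zero]
      rintro ⟨huD, hadj⟩
      rw [hPD v hv u hu huD] at hadj
      exact G.irrefl hadj
    · have hout : ∀ w, G.Adj u w → w ≠ v → z w = 0 := fun w hw hne =>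
        hz0 w fun hwP => hu (hcut v hv w hwP hne u hw.symm)
      by_cases hadj : G.Adj v u
      · rw [adjMatrix_mulVec_eq_of_unique_adj G hadj.symm hout,
          if_pos ⟨hroot v hv u hadj hu, hadj⟩, inv_mul_cancel₀ hzv]
      · rw [if_neg fun h => hadj h.2, adjMatrix_mulVec_eq_zero, mul_zero]
        refine fun w hw => hout w hw ?_
        rintro rfl
        exact hadj hw.symm
  choose! z hz0 hz1 hz using hnorm
  have hdot : ∀ v ∈ D, ∀ x : V → ℝ, z v ⬝ᵥ (G.adjMatrix ℝ *ᵥ x) =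
      (G.adjMatrix ℝ *ᵥ fun u => if u ∈ D then x u else 0) v := by
    intro v hv x
    rw [dotProduct_adjMatrix_mulVec_comm, adjMatrix_mulVec_eq_sum_ite, dotProduct]
    refine Finset.sum_congr rfl fun u _ => ?_
    rw [hz v hv]
    by_cases h1 : u ∈ D <;> by_cases h2 : G.Adj v u <;> simp [h1, h2]
  constructor
  · rintro ⟨x, hx0, -, hx⟩
    have hxA : G.adjMatrix ℝ *ᵥ x = 0 := funext fun u => hx u trivial
    by_cases hxD : ∀ u ∈ D, x u = 0
    · exact Or.inl ⟨x, hx0, fun u hu => hxD u (by simpa using hu), fun u _ => hx u trivial⟩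
    · refine Or.inr ⟨fun u => if u ∈ D then x u else 0, fun h0 => hxD fun u hu => ?_,
        fun u hu => if_neg hu, fun v hv => ?_⟩
      · simpa [hu] using congrFun h0 u
      · rw [← hdot v hv, hxA, dotProduct_zero]
  · rintro (⟨x, hx0, hx1, hx⟩ | ⟨c, hc0, hc1, hc⟩)
    · refine ⟨x, hx0, by simp, fun v _ => ?_⟩
      by_cases hv : v ∈ D
      -- The right side of `hdot` is 0 since `x` vanishes on `D`. On the left only the term at `v`
      -- survives: `z v` meets `D` only in `v`, and `A x` vanishes off `D`.
      · have h1 := hdot v hv x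
        rw [adjMatrix_mulVec_eq_zero G (fun u _ => ?_), dotProduct,
          Finset.sum_eq_single v (fun u _ huv => ?_) (by simp), hz1 v hv, one_mul] at h1
        · exact h1
        · by_cases hu : u ∈ D
          · rw [hz0 v hv u fun h => huv (hPD v hv u h hu), zero_mul]
          · rw [hx u hu, mul_zero]
        · by_cases hu : u ∈ D
          · rw [if_pos hu, hx1 u (by simpa using hu)]
          · rw [if_neg hu]
      · exact hx v hv
    · refine ⟨∑ v, c v • z v, fun h0 => hc0 ?_, by simp, fun u _ => ?_⟩
      · funext v
        by_cases hv : v ∈ D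
        · have h1 := congrFun h0 v
          rw [Finset.sum_apply, Finset.sum_eq_single v (fun u _ huv => ?_) (by simp)] at h1
          · simpa [hz1 v hv] using h1
          · by_cases hu : u ∈ D
            · rw [Pi.smul_apply, hz0 u hu v fun h => huv (hPD u hu v h hv).symm, smul_zero]
            · simp [hc1 u hu]
        · exact hc1 v hv
      · have hsum : (G.adjMatrix ℝ *ᵥ ∑ v, c v • z v) u =
            ∑ v, c v * (G.adjMatrix ℝ *ᵥ z v) u := by
          rw [mulVec_sum, Finset.sum_apply]
          exact Finset.sum_congr rfl fun v _ => by rw [mulVec_smul]; rfl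
        rw [hsum]
        by_cases hu : u ∈ D
        · rw [← hc u hu, adjMatrix_mulVec_eq_sum_ite]
          refine Finset.sum_congr rfl fun v _ => ?_
          by_cases hv : v ∈ D
          · rw [hz v hv]
            simp [hu, G.adj_comm u v]
          · simp [hc1 v hv]
        · refine Finset.sum_eq_zero fun v _ => ?_
          by_cases hv : v ∈ D
          · rw [hz v hv]
            simp [hu]
          · simp [hc1 v hv]

/-! ### Null vectors of a cycle -/

section Cycle

variable {G : SimpleGraph V} {u : V} {p : G.Walk u u}

/-- Indices modulo the length treat the base point like any other vertex; centring at `i + 1` avoids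
subtraction. -/
theorem Walk.IsCycle.neighborSet_toSubgraph_getVert_mod (hp : p.IsCycle) (i : ℕ) :
    p.toSubgraph.neighborSet (p.getVert ((i + 1) % p.length)) =
      {p.getVert (i % p.length), p.getVert ((i + 2) % p.length)} := by
  have h3 := hp.three_le_length
  have hr : i % p.length < p.length := Nat.mod_lt _ (by omega)
  rw [Nat.add_mod i 1, Nat.add_mod i 2, Nat.mod_eq_of_lt (a := 1) (by omega),
    Nat.mod_eq_of_lt (a := 2) (by omega)]
  generalize i % p.length = r at hr ⊢
  by_cases h : r + 1 = p.length
  · rw [h, Nat.mod_self, show r + 2 = 1 + p.length by omega, Nat.add_mod_right,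
      Nat.mod_eq_of_lt (a := 1) (by omega), p.getVert_zero, hp.neighborSet_toSubgraph_endpoint,
      Set.pair_comm, show r = p.length - 1 by omega]
  · rw [Nat.mod_eq_of_lt (a := r + 1) (by omega),
      hp.neighborSet_toSubgraph_internal (by omega) (by omega), Nat.add_sub_cancel]
    by_cases h' : r + 2 = p.length
    · rw [h', Nat.mod_self, p.getVert_zero, p.getVert_length]
    · rw [Nat.mod_eq_of_lt (a := r + 2) (by omega)]

theorem Walk.IsCycle.getVert_mod_ne (hp : p.IsCycle) (i : ℕ) :
    p.getVert (i % p.length) ≠ p.getVert ((i + 2) % p.length) := by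
  have h3 := hp.three_le_length
  intro h
  have h1 := Nat.mod_lt i (y := p.length) (by omega)
  have h2 := Nat.mod_lt (i + 2) (y := p.length) (by omega)
  have h4 : i + 2 ≡ i + 0 [MOD p.length] :=
    (hp.getVert_injOn' (by simp only [Set.mem_ofPred_eq]; omega)
      (by simp only [Set.mem_ofPred_eq]; omega) h).symm
  have h5 := Nat.ModEq.add_left_cancel' i h4
  rw [Nat.ModEq, Nat.mod_eq_of_lt (by omega), Nat.zero_mod] at h5
  omega

theorem Walk.IsCycle.exists_getVert_mod_eq (hp : p.IsCycle) {v : V}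
    (hv : v ∈ p.toSubgraph.verts) : ∃ i < p.length, p.getVert (i % p.length) = v := by
  have h3 := hp.three_le_length
  rw [mem_verts_toSubgraph, mem_support_iff_exists_getVert] at hv
  obtain ⟨i, rfl, hi⟩ := hv
  by_cases h : i = p.length
  · subst h
    exact ⟨0, by omega, by simp⟩
  · exact ⟨i, by omega, by rw [Nat.mod_eq_of_lt (by omega)]⟩

theorem Walk.IsCycle.adjMatrix_mulVec_getVert [Fintype V] (hp : p.IsCycle)
    (hind : p.toSubgraph.IsInduced) {x : V → ℝ} (hx : ∀ v ∉ p.toSubgraph.verts, x v = 0) (i : ℕ) :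
    (G.adjMatrix ℝ *ᵥ x) (p.getVert ((i + 1) % p.length)) =
      x (p.getVert (i % p.length)) + x (p.getVert ((i + 2) % p.length)) := by
  have hN := hp.neighborSet_toSubgraph_getVert_mod i
  have hne := hp.getVert_mod_ne i
  set a := p.getVert ((i + 1) % p.length)
  set b := p.getVert (i % p.length)
  set c := p.getVert ((i + 2) % p.length)
  have hmem : ∀ w, p.toSubgraph.Adj a w ↔ w = b ∨ w = c := fun w => by
    rw [← Subgraph.mem_neighborSet, hN]
    rfl
  have hab := (hmem b).2 (Or.inl rfl)
  have hac := (hmem c).2 (Or.inr rfl)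
  rw [adjMatrix_mulVec_apply, ← Finset.sum_pair hne]
  symm
  refine Finset.sum_subset ?_ fun w hw hw' => hx w fun hwC => hw' ?_
  · intro w hw
    rw [Finset.mem_insert, Finset.mem_singleton] at hw
    rw [mem_neighborFinset]
    rcases hw with rfl | rfl
    · exact hab.adj_sub
    · exact hac.adj_sub
  · rw [mem_neighborFinset] at hw
    rw [Finset.mem_insert, Finset.mem_singleton, ← hmem]
    exact hind hab.fst_mem hwC hw

/-- The cycle of length `n` is singular if and only if `4` divides `n`. -/
theorem Walk.IsCycle.singularOn_verts_iff [Fintype V] (hp : p.IsCycle)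
    (hind : p.toSubgraph.IsInduced) :
    G.SingularOn p.toSubgraph.verts ↔ 4 ∣ p.length := by
  have h3 := hp.three_le_length
  have hvert : ∀ i, p.getVert i ∈ p.toSubgraph.verts := fun i => by
    rw [mem_verts_toSubgraph]
    exact p.getVert_mem_support i
  constructor
  · rintro ⟨x, hx0, hx1, hx⟩
    by_contra h4
    have hrec : ∀ i, x (p.getVert ((i + 2) % p.length)) = -x (p.getVert (i % p.length)) := by
      intro i
      have h1 := hp.adjMatrix_mulVec_getVert hind hx1 i
      rw [hx _ (hvert _)] at h1
      linarith
    have hiter : ∀ k i, x (p.getVert ((i + 2 * k) % p.length)) =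
        (-1) ^ k * x (p.getVert (i % p.length)) := by
      intro k i
      induction k with
      | zero => simp
      | succ k ih =>
        rw [show i + 2 * (k + 1) = i + 2 * k + 2 by ring, hrec, ih]
        ring
    -- If 4 does not divide the length, an odd number of double steps returns to the start, so each
    -- value equals its negative.
    obtain ⟨k, hk, m, hm⟩ : ∃ k, Odd k ∧ ∃ m, 2 * k = p.length * m := by
      rcases Nat.even_or_odd p.length with ⟨k, hk⟩ | hodd
      · refine ⟨k, ?_, 1, by omega⟩
        rw [← Nat.not_even_iff_odd]
        rintro ⟨j, hj⟩
        exact h4 ⟨j, by omega⟩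
      · exact ⟨p.length, hodd, 2, by ring⟩
    refine hx0 (funext fun v => ?_)
    by_cases hv : v ∈ p.toSubgraph.verts
    · obtain ⟨i, -, rfl⟩ := hp.exists_getVert_mod_eq hv
      have h1 := hiter k i
      rw [hm, Nat.add_mul_mod_self_left, hk.neg_one_pow] at h1
      simp only [Pi.zero_apply]
      linarith
    · exact hx1 v hv
  · intro h4
    -- The pattern 1, 0, -1, 0 closes up around the cycle because 4 divides its length.
    let s : ℕ → ℝ := fun i => if i % 4 = 0 then 1 else if i % 4 = 2 then -1 else 0
    have hinj : ∀ i j, p.getVert (i % p.length) = p.getVert (j % p.length) → s i = s j := by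
      intro i j hij
      have h1 := Nat.mod_lt i (y := p.length) (by omega)
      have h2 := Nat.mod_lt j (y := p.length) (by omega)
      have h5 : i % p.length = j % p.length :=
        hp.getVert_injOn' (by simp only [Set.mem_ofPred_eq]; omega)
          (by simp only [Set.mem_ofPred_eq]; omega) hij
      have h6 : i % 4 = j % 4 := Nat.ModEq.of_dvd h4 h5
      simp only [s, h6]
    let x : V → ℝ := fun v => if h : ∃ i, p.getVert (i % p.length) = v then s h.choose else 0
    have hx : ∀ i, x (p.getVert (i % p.length)) = s i := by
      intro i
      have h : ∃ j, p.getVert (j % p.length) = p.getVert (i % p.length) := ⟨i, rfl⟩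
      simp only [x, dif_pos h]
      exact hinj _ _ h.choose_spec
    have hx1 : ∀ v ∉ p.toSubgraph.verts, x v = 0 := by
      intro v hv
      refine dif_neg ?_
      rintro ⟨i, rfl⟩
      exact hv (hvert _)
    refine ⟨x, fun h0 => ?_, hx1, fun v hv => ?_⟩
    · have := hx 0
      rw [h0] at this
      simp [s] at this
    · obtain ⟨i, -, rfl⟩ := hp.exists_getVert_mod_eq hv
      have hi : i % p.length = (i + (p.length - 1) + 1) % p.length := by
        rw [show i + (p.length - 1) + 1 = i + p.length by omega, Nat.add_mod_right]
      rw [hi, hp.adjMatrix_mulVec_getVert hind hx1, hx, hx]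
      generalize i + (p.length - 1) = j
      simp only [s]
      have : j % 4 < 4 := Nat.mod_lt _ (by norm_num)
      have h2 : (j + 2) % 4 = (j % 4 + 2) % 4 := by omega
      rw [h2]
      interval_cases j % 4 <;> norm_num

theorem Walk.IsCycle.ncard_edgeSet_toSubgraph (hp : p.IsCycle) :
    p.toSubgraph.edgeSet.ncard = p.length := by
  have h : p.toSubgraph.edgeSet = (p.edges.toFinset : Set (Sym2 V)) := by
    ext e
    simp
  rw [h, Set.ncard_coe_finset, List.toFinset_card_of_nodup hp.edges_nodup, p.length_edges]

end Cycle

/-! ### Structure of unicyclic graphs -/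

section Unicyclic

variable {G : SimpleGraph V} {C : G.Subgraph}

theorem IsUnicyclic.toSubgraph_eq (hG : G.IsUnicyclic) (hC : C.IsCycleGraph) {u : V}
    {p : G.Walk u u} (hp : p.IsCycle) : p.toSubgraph = C :=
  hG.2.unique ⟨u, p, hp, rfl⟩ hC

theorem Subgraph.IsCycleGraph.exists_walk (hC : C.IsCycleGraph) {a b : V} (ha : a ∈ C.verts)
    (hb : b ∈ C.verts) : ∃ q : G.Walk a b, ∀ e ∈ q.edges, e ∈ C.edgeSet := by
  obtain ⟨u, p, hp, rfl⟩ := hC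
  rw [Walk.mem_verts_toSubgraph] at ha hb
  have hb' : b ∈ (p.rotate a ha).support := by rwa [Walk.mem_support_rotate_iff]
  refine ⟨(p.rotate a ha).takeUntil b hb', fun e he => ?_⟩
  rw [Walk.mem_edges_toSubgraph]
  exact (p.rotate_edges a ha).mem_iff.1 (Walk.edges_takeUntil_subset_edges _ _ he)

/-- An edge off the only cycle lies on no cycle, hence is a bridge. -/
theorem IsUnicyclic.mem_edges_of_not_adj (hG : G.IsUnicyclic) (hC : C.IsCycleGraph) {a b : V}
    (hab : G.Adj a b) (hn : ¬ C.Adj a b) (q : G.Walk a b) : s(a, b) ∈ q.edges := by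
  refine isBridge_iff_forall_walk_mem_edges.1
    ((isBridge_iff_forall_cycle_notMem hab).2 fun u p hp he => hn ?_) q
  rw [← hG.toSubgraph_eq hC hp]
  rwa [← Walk.mem_edges_toSubgraph] at he

theorem IsUnicyclic.isInduced (hG : G.IsUnicyclic) (hC : C.IsCycleGraph) : C.IsInduced := by
  intro a ha b hb hab
  by_contra hn
  obtain ⟨q, hq⟩ := hC.exists_walk ha hb
  exact hn (hq _ (hG.mem_edges_of_not_adj hC hab hn q))

theorem eq_of_mem_pendantVerts {v w : V} (hw : w ∈ G.pendantVerts C v) (hwC : w ∈ C.verts) :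
    w = v :=
  (G.isGreatest_pendantVerts C v).1.2.1 w hw hwC

theorem mem_pendantVerts_of_adj {v w u : V} (hw : w ∈ G.pendantVerts C v) (hwu : G.Adj w u)
    (hu : u ∉ C.verts) : u ∈ G.pendantVerts C v := by
  obtain ⟨q, hq⟩ := hw
  refine ⟨q.concat hwu, fun x hx hxC => ?_⟩
  rw [Walk.support_concat, List.mem_append, List.mem_singleton] at hx
  rcases hx with hx | rfl
  · exact hq x hx hxC
  · exact absurd hxC hu

theorem IsUnicyclic.mem_pendantVerts_of_adj (hG : G.IsUnicyclic) (hC : C.IsCycleGraph) {v w u : V}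
    (hv : v ∈ C.verts) (hw : w ∈ G.pendantVerts C v) (hne : w ≠ v) (hwu : G.Adj w u) :
    u ∈ G.pendantVerts C v := by
  by_cases hu : u ∈ C.verts
  swap
  · exact SimpleGraph.mem_pendantVerts_of_adj hw hwu hu
  by_cases huv : u = v
  · rw [huv]
    exact G.mem_pendantVerts_self C v
  have hwC : w ∉ C.verts := fun h => hne (eq_of_mem_pendantVerts hw h)
  obtain ⟨q, hq⟩ := hw
  obtain ⟨r, hr⟩ := hC.exists_walk hv hu
  -- The edge `wu` would be a bridge, yet the walk back to `v` inside the pendant tree and then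
  -- along `C` to `u` avoids it.
  have := hG.mem_edges_of_not_adj hC hwu (fun h => hwC h.fst_mem) (q.reverse.append r)
  rw [Walk.edges_append, List.mem_append, Walk.edges_reverse, List.mem_reverse] at this
  rcases this with h | h
  · exact absurd (hq u (q.snd_mem_support_of_mem_edges h) hu) huv
  · exact absurd (C.edge_vert (hr _ h)) hwC

/-- A cycle inside `S` is a cycle of `G`, hence is `C` itself. -/
theorem IsUnicyclic.isAcyclic_induce (hG : G.IsUnicyclic) (hC : C.IsCycleGraph) {S : Set V}
    (hS : ¬ C.verts ⊆ S) : (G.induce S).IsAcyclic := by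
  intro u p hp
  refine hS ?_
  have hinj : Function.Injective (Embedding.induce (G := G) S).toHom := Subtype.val_injective
  rw [← hG.toSubgraph_eq hC (hp.map hinj)]
  intro w hw
  rw [Walk.mem_verts_toSubgraph, Walk.support_map] at hw
  obtain ⟨y, -, rfl⟩ := List.mem_map.1 hw
  exact y.2

theorem Subgraph.IsCycleGraph.nonempty_verts (hC : C.IsCycleGraph) : C.verts.Nonempty := by
  obtain ⟨u, p, -, rfl⟩ := hC
  exact ⟨u, p.start_mem_verts_toSubgraph⟩

theorem Subgraph.IsCycleGraph.not_verts_subset_pendantVerts (hC : C.IsCycleGraph) (v : V) :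
    ¬ C.verts ⊆ G.pendantVerts C v := by
  intro h
  obtain ⟨u, p, hp, rfl⟩ := hC
  have hadj := p.toSubgraph_adj_snd hp.not_nil
  exact hadj.ne ((eq_of_mem_pendantVerts (h hadj.fst_mem) hadj.fst_mem).trans
    (eq_of_mem_pendantVerts (h hadj.snd_mem) hadj.snd_mem).symm)

end Unicyclic

end SimpleGraph

/-! ### The singularity criterion -/

open SimpleGraph

theorem theorem3 {V : Type*} [Finite V] (G : SimpleGraph V) (hG : G.IsUnicyclic)
    (C : G.Subgraph) (hC : C.IsCycleGraph) :
    G.IsSingular ↔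
      (∃ v ∈ C.verts, G.pendantRoot C v ∉ (G.pendantTree C v).nullSupport ∧
        (¬ (G.pendantTree C v).HasPerfectMatching ∨
          ¬ (G.induce (G.pendantVerts C v)ᶜ).HasPerfectMatching)) ∨
      ((∀ v ∈ C.verts, G.pendantRoot C v ∈ (G.pendantTree C v).nullSupport) ∧
        ((∃ T : (G.induce C.vertsᶜ).ConnectedComponent, ¬ T.toSimpleGraph.HasPerfectMatching) ∨
          4 ∣ C.edgeSet.ncard)) := by
  have := Fintype.ofFinite V
  have hsupp : ∀ v, G.pendantRoot C v ∈ (G.pendantTree C v).nullSupport ↔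
      ∃ x, G.IsKernelOn (G.pendantVerts C v) x ∧ x v ≠ 0 := fun v =>
    G.mem_nullSupport_induce_iff (G.pendantVerts C v) (G.pendantRoot C v)
  have hforest : ∀ S : Set V, ¬ C.verts ⊆ S →
      (G.SingularOn S ↔ ¬ (G.induce S).HasPerfectMatching) := fun S hS => by
    rw [hasPerfectMatching_induce_iff]
    exact G.singularOn_iff_not_matchedOn S (hG.isAcyclic_induce hC hS)
  have hpend := fun v => hforest _ (hC.not_verts_subset_pendantVerts v)
  have hcompl : ∀ v ∈ C.verts, ¬ C.verts ⊆ (G.pendantVerts C v)ᶜ := fun v hv h =>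
    h hv (G.mem_pendantVerts_self C v)
  -- The criterion holds at every unsupported `v`, so the existential in (i) does not depend on
  -- which one is chosen.
  have hunsupp : ∀ v ∈ C.verts, G.pendantRoot C v ∉ (G.pendantTree C v).nullSupport →
      (G.IsSingular ↔ ¬ (G.pendantTree C v).HasPerfectMatching ∨
          ¬ (G.induce (G.pendantVerts C v)ᶜ).HasPerfectMatching) := by
    intro v hv hvs
    rw [hsupp] at hvs
    push Not at hvs
    rw [isSingular_iff_singularOn_univ,
      G.singularOn_univ_iff_of_notMem_support (G.mem_pendantVerts_self C v)
        (fun u hu hne w hw => hG.mem_pendantVerts_of_adj hC hv hu hne hw)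
        (hG.isAcyclic_induce hC (hC.not_verts_subset_pendantVerts v)).isBipartite hvs,
      hpend v, hforest _ (hcompl v hv)]
    rfl
  by_cases hall : ∀ v ∈ C.verts, G.pendantRoot C v ∈ (G.pendantTree C v).nullSupport
  · have hcycle : G.SingularOn C.verts ↔ 4 ∣ C.edgeSet.ncard := by
      have hind := hG.isInduced hC
      obtain ⟨u, p, hp, rfl⟩ := hC
      rw [hp.ncard_edgeSet_toSubgraph, hp.singularOn_verts_iff hind]
    have hself : ¬ C.verts ⊆ C.vertsᶜ := fun h =>
      have ⟨w, hw⟩ := hC.nonempty_verts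
      h hw hw
    rw [isSingular_iff_singularOn_univ,
      G.singularOn_univ_iff_of_forall_mem_support (D := C.verts) (P := G.pendantVerts C)
        (fun v _ w hw hwC => eq_of_mem_pendantVerts hw hwC)
        (fun v hv w hw hne u hu => hG.mem_pendantVerts_of_adj hC hv hw hne hu)
        (fun v _ u hu hn => by
          by_contra huC
          exact hn (SimpleGraph.mem_pendantVerts_of_adj (G.mem_pendantVerts_self C v) hu huC))
        (fun v hv => (hsupp v).1 (hall v hv)),
      hforest _ hself, hcycle, hasPerfectMatching_iff_forall_connectedComponent, not_forall]
    refine ⟨fun h => Or.inr ⟨hall, h⟩, ?_⟩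
    rintro (⟨v, hv, hvs, -⟩ | ⟨-, h⟩)
    · exact absurd (hall v hv) hvs
    · exact h
  · refine ⟨fun h => ?_, ?_⟩
    · push Not at hall
      obtain ⟨v, hv, hvs⟩ := hall
      exact Or.inl ⟨v, hv, hvs, (hunsupp v hv hvs).1 h⟩
    · rintro (⟨v, hv, hvs, h⟩ | ⟨h, -⟩)
      · exact (hunsupp v hv hvs).2 h
      · exact absurd h hall
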